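/- Let $X,Y$ be Polish spaces, $\mu\in\mathcal P(X)$ and $\nu\in\mathcal P(Y)$ Borel probability measures, and $\varepsilon>0$. Let $c:X\times Y\to\mathbb R$ be Borel, bounded from below, and such that $c(x,y)\le a(x)+b(y)$ for all $(x,y)$, for some real-valued $a\in L^1(\mu)$, $b\in L^1(\nu)$. Write $\mathrm{Cpl}(\mu,\nu)$ for the set of probability measures on $X\times Y$ with marginals $\mu,\nu$, and $H(Q|R)=\int\log\frac{dQ}{dR}\,dQ$ if $Q\ll R$, $H(Q|R)=+\infty$ otherwise, for the relative entropy of probability measures. The entropic optimal transport problem is $$\inf_{\pi\in\mathrm{Cpl}(\mu,\nu)}\ \int c\,d\pi+\varepsilon H(\pi|\mu\otimes\nu).\tag{P}$$ For a probability measure $\rho$, let $\mathcal L^1(\rho)$ be the set of $\rho$-integrable Borel functions with values in $[-\infty,\infty)$ (functions, not equivalence classes). The weak transport dual problem is $$\sup\ \int f\,d\mu+\int g\,d\nu,\tag{D}$$ where the supremum runs over all admissible pairs, that is, all $(f,g)\in\mathcal L^1(\mu)\times\mathcal L^1(\nu)$ such that $$f(x)+\int g\,d\rho\le\int c(x,\cdot)\,d\rho+\varepsilon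 H(\rho|\nu)\quad\text{for all }x\in X\text{ and all }\rho\in\mathcal P(Y)\text{ with }g\in\mathcal L^1(\rho).$$ **Theorem.** Let $\pi\in\mathrm{Cpl}(\mu,\nu)$. Then $\pi$ is optimal for (P) if and only if there exist measurable $f:X\to\mathbb R$ and $g:Y\to\mathbb R$ such that $\pi\ll\mu\otimes\nu$ and $$\frac{d\pi}{d(\mu\otimes\nu)}(x,y)=\exp\Big(\frac{-c(x,y)+f(x)+g(y)}{\varepsilon}\Big)\qquad\text{for }\mu\otimes\nu\text{-a.e. }(x,y).\tag{1}$$ Moreover, whenever measurable $f:X\to\mathbb R$ and $g:Y\to\mathbb R$ satisfy (1), the pair $(f,g)$ is optimal for (D), up to changing $f$ on a $\mu$-null set: there is $f':X\to[-\infty,\infty)$ with $f'=f$ $\mu$-a.e. such that $(f',g)$ is admissible and attains the supremum in (D). -/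

import Mathlib

open MeasureTheory

noncomputable section

namespace EntropicOT

variable {X Y Z : Type*} [MeasurableSpace X] [MeasurableSpace Y] [MeasurableSpace Z]

/-- The integral of `h` with respect to `ρ` as an extended real number, i.e. the integral of the
positive part minus the integral of the negative part. It is only used for measurable functions
that are bounded from below and for probability measures `ρ`, where the negative part has a
finite integral and the value lies in `(-∞, ∞]`. -/
def extIntegral (ρ : Measure Z) (h : Z → ℝ) : EReal :=
  ((∫⁻ z, ENNReal.ofReal (h z) ∂ρ : ENNReal) : EReal) -
    ((∫⁻ z, ENNReal.ofReal (-h z) ∂ρ : ENNReal) : EReal)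

/-- `Cpl(μ, ν)`: the probability measures on `X × Y` with marginals `μ` and `ν`. -/
def Cpl (μ : Measure X) (ν : Measure Y) : Set (Measure (X × Y)) :=
  {π | IsProbabilityMeasure π ∧ π.fst = μ ∧ π.snd = ν}

/-- The primal functional `∫ c dπ + ε H(π | μ ⊗ ν)`. For probability measures, Mathlib's `klDiv` is
the relative entropy: `∫ log (dπ/dκ) dπ` if `π ≪ κ`, and `∞` otherwise. -/
def entropicCost (c : X × Y → ℝ) (ε : ℝ) (μ : Measure X) (ν : Measure Y)
    (π : Measure (X × Y)) : EReal :=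
  extIntegral π c + (ε : EReal) * (InformationTheory.klDiv π (μ.prod ν) : EReal)

/-- The value of the entropic optimal transport problem. -/
def entropicValue (c : X × Y → ℝ) (ε : ℝ) (μ : Measure X) (ν : Measure Y) : EReal :=
  ⨅ π ∈ Cpl μ ν, entropicCost c ε μ ν π

/-- `π` is an optimal coupling: it attains the infimum. -/
def IsPrimalOptimal (c : X × Y → ℝ) (ε : ℝ) (μ : Measure X) (ν : Measure Y)
    (π : Measure (X × Y)) : Prop :=
  π ∈ Cpl μ ν ∧ entropicCost c ε μ ν π = entropicValue c ε μ ν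

/-- The weak transport cost `C(x, ρ) = ∫ c(x, ·) dρ + ε H(ρ | ν)`, which is `+∞` if `ρ` is not
absolutely continuous with respect to `ν`. -/
def weakCost (c : X × Y → ℝ) (ε : ℝ) (ν : Measure Y) (x : X) (ρ : Measure Y) : EReal :=
  extIntegral ρ (fun y => c (x, y)) + (ε : EReal) * (InformationTheory.klDiv ρ ν : EReal)

/-- `𝓛¹(ρ)`: the `ρ`-integrable measurable functions with values in `[-∞, ∞)`. These are functions,
not equivalence classes. -/
structure IsL1 (ρ : Measure Z) (h : Z → EReal) : Prop where
  measurable : Measurable h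
  ne_top : ∀ z, h z ≠ ⊤
  ae_ne_bot : ∀ᵐ z ∂ρ, h z ≠ ⊥
  integrable : Integrable (fun z => (h z).toReal) ρ

/-- The (real) integral of a function in `𝓛¹(ρ)`; the `ρ`-null set on which the function is `-∞`
plays no role. -/
def integralL1 (ρ : Measure Z) (h : Z → EReal) : ℝ :=
  ∫ z, (h z).toReal ∂ρ

/-- Admissible pairs of the dual of the weak transport problem: `f ∈ 𝓛¹(μ)`, `g ∈ 𝓛¹(ν)` and
`f(x) + ρ(g) ≤ C(x, ρ)` for all `x` and all probability measures `ρ` with `g ∈ 𝓛¹(ρ)`. -/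
structure IsDualAdmissible (c : X × Y → ℝ) (ε : ℝ) (μ : Measure X) (ν : Measure Y)
    (f : X → EReal) (g : Y → EReal) : Prop where
  left : IsL1 μ f
  right : IsL1 ν g
  le : ∀ (x : X) (ρ : Measure Y), IsProbabilityMeasure ρ → IsL1 ρ g →
    f x + (integralL1 ρ g : EReal) ≤ weakCost c ε ν x ρ

/-- The dual functional `μ(f) + ν(g)`. -/
def dualObjective (μ : Measure X) (ν : Measure Y) (f : X → EReal) (g : Y → EReal) : EReal :=
  ((integralL1 μ f + integralL1 ν g : ℝ) : EReal)

/-- The value of the dual problem. -/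
def dualValue (c : X × Y → ℝ) (ε : ℝ) (μ : Measure X) (ν : Measure Y) : EReal :=
  ⨆ (f : X → EReal) (g : Y → EReal) (_ : IsDualAdmissible c ε μ ν f g), dualObjective μ ν f g

/-- `(f, g)` is optimal in the dual problem: it is admissible and attains the supremum. -/
def IsDualOptimal (c : X × Y → ℝ) (ε : ℝ) (μ : Measure X) (ν : Measure Y)
    (f : X → EReal) (g : Y → EReal) : Prop :=
  IsDualAdmissible c ε μ ν f g ∧ dualObjective μ ν f g = dualValue c ε μ ν

/-- `dπ/d(μ ⊗ ν) = exp ((-c + f ⊕ g) / ε)`: `π` is absolutely continuous with respect to `μ ⊗ ν`,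
and its Radon-Nikodym derivative is given by this formula up to a `μ ⊗ ν`-null set. -/
def HasGibbsDensity (c : X × Y → ℝ) (ε : ℝ) (μ : Measure X) (ν : Measure Y)
    (π : Measure (X × Y)) (f : X → ℝ) (g : Y → ℝ) : Prop :=
  π.AbsolutelyContinuous (μ.prod ν) ∧
    ∀ᵐ p ∂(μ.prod ν), π.rnDeriv (μ.prod ν) p =
      ENNReal.ofReal (Real.exp ((-c p + (f p.1 + g p.2)) / ε))

end EntropicOT

end

/-! Everything rests on the Gibbs inequality `∫ h dρ ≤ H(ρ|κ)` whenever `∫ exp h dκ ≤ 1`, with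
equality at `ρ = exp h · κ`. With `κ = μ ⊗ ν` and `h = (f ⊕ g - c)/ε` it bounds the cost of every
coupling below by `μ(f) + ν(g)`, and the coupling of the form (1) attains this bound. With `κ = ν`
and `x` fixed it is the admissibility of `(f, g)` at each `x` whose section has mass at most one.
Conversely, testing an admissible pair against the conditional laws of `π` bounds its dual value by
`μ(f) + ν(g)`. These arguments need `f` and `g` integrable: `HasGibbsDensity.integrable_potentials`.

For necessity, let `z` be the density of an optimizer and `ψ = c + ε log z`. The infinite slope of
`t log t` at `0` forces `z > 0` a.e. (`IsOptimalDensity.ae_pos`). Then mass is moved from `(x, y),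
(x', y')` to `(x, y'), (x', y)` or back, with a bounded weight whose sign is opposite to the cross
difference `D` of `ψ`. This keeps the marginals, and the first variation of the cost is `-(1/4) ∫ D²
/ (1 + |D|)` over the quadruples used. Optimality makes it nonnegative, so `D = 0` a.e., and
freezing one point splits `ψ` as `f ⊕ g`, which is (1). -/

open scoped ENNReal

namespace EntropicOT

/-! ### The Gibbs inequality and the functional `∫ c dρ + ε H(ρ|κ)` -/

section Functional

variable {Z : Type*} [MeasurableSpace Z] {ρ κ : Measure Z}

theorem extIntegral_eq_integral {h : Z → ℝ} (hh : Integrable h ρ) :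
    extIntegral ρ h = ((∫ z, h z ∂ρ : ℝ) : EReal) := by
  have h1 : ∫⁻ z, ENNReal.ofReal (h z) ∂ρ ≠ ∞ := hh.lintegral_lt_top.ne
  have h2 : ∫⁻ z, ENNReal.ofReal (-h z) ∂ρ ≠ ∞ := hh.neg.lintegral_lt_top.ne
  rw [extIntegral, integral_eq_lintegral_pos_part_sub_lintegral_neg_part hh, EReal.coe_sub,
    EReal.coe_ennreal_toReal h1, EReal.coe_ennreal_toReal h2]

theorem lintegral_ofReal_neg_ne_top [IsFiniteMeasure ρ] {h : Z → ℝ} {m : ℝ} (hm : ∀ z, m ≤ h z) :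
    ∫⁻ z, ENNReal.ofReal (-h z) ∂ρ ≠ ∞ := by
  refine ((lintegral_mono fun z => ENNReal.ofReal_le_ofReal (neg_le_neg (hm z))).trans_lt ?_).ne
  rw [lintegral_const]
  exact ENNReal.mul_lt_top ENNReal.ofReal_lt_top (measure_lt_top _ _)

theorem extIntegral_ne_bot [IsFiniteMeasure ρ] {h : Z → ℝ} {m : ℝ} (hm : ∀ z, m ≤ h z) :
    extIntegral ρ h ≠ ⊥ := by
  have h2 := lintegral_ofReal_neg_ne_top (ρ := ρ) hm
  rw [extIntegral, sub_eq_add_neg, Ne, EReal.add_eq_bot_iff, EReal.neg_eq_bot_iff]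
  simpa using h2

theorem extIntegral_eq_top [IsFiniteMeasure ρ] {h : Z → ℝ} (hmeas : Measurable h) {m : ℝ}
    (hm : ∀ z, m ≤ h z) (hh : ¬ Integrable h ρ) : extIntegral ρ h = ⊤ := by
  have h2 := lintegral_ofReal_neg_ne_top (ρ := ρ) hm
  have h1 : ∫⁻ z, ENNReal.ofReal (h z) ∂ρ = ∞ := by
    by_contra h1
    refine hh ⟨hmeas.aestronglyMeasurable, ?_⟩
    rw [hasFiniteIntegral_iff_norm]
    have : ∀ z, ENNReal.ofReal ‖h z‖ ≤ ENNReal.ofReal (h z) + ENNReal.ofReal (-h z) := fun z => by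
      rcases le_total 0 (h z) with hz | hz
      · rw [Real.norm_of_nonneg hz]; exact le_self_add
      · rw [Real.norm_of_nonpos hz]; exact le_add_self
    refine (lintegral_mono this).trans_lt ?_
    rw [lintegral_add_left hmeas.ennreal_ofReal]
    exact ENNReal.add_lt_top.2 ⟨lt_top_iff_ne_top.2 h1, lt_top_iff_ne_top.2 h2⟩
  rw [extIntegral, h1, sub_eq_add_neg, EReal.coe_ennreal_top, EReal.top_add_of_ne_bot]
  simpa [EReal.neg_eq_bot_iff] using h2

/-- Fenchel–Young for `p log p - p`, whose conjugate is `exp`; it is `1 + u ≤ exp u` at `u = h - log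
p`, multiplied by `p`. -/
theorem mul_le_mul_log_add_exp_sub {p : ℝ} (hp : 0 ≤ p) (h : ℝ) :
    p * h ≤ p * Real.log p + (Real.exp h - p) := by
  rcases hp.eq_or_lt with rfl | hp
  · simpa using (Real.exp_pos h).le
  · have h1 := Real.add_one_le_exp (h - Real.log p)
    rw [Real.exp_sub, Real.exp_log hp, le_div_iff₀ hp] at h1
    nlinarith

/-- The Gibbs variational inequality. -/
theorem integral_le_integral_llr [IsProbabilityMeasure ρ] [IsProbabilityMeasure κ] (hac : ρ ≪ κ)
    (hint : Integrable (llr ρ κ) ρ) {h : Z → ℝ} (hmeas : Measurable h) (hh : Integrable h ρ)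
    (hexp : ∫⁻ z, ENNReal.ofReal (Real.exp (h z)) ∂κ ≤ 1) :
    ∫ z, h z ∂ρ ≤ ∫ z, llr ρ κ z ∂ρ := by
  have hexp_int : Integrable (fun z => Real.exp (h z)) κ := by
    refine ⟨hmeas.exp.aestronglyMeasurable, ?_⟩
    rw [hasFiniteIntegral_iff_ofReal (ae_of_all _ fun z => (Real.exp_pos _).le)]
    exact hexp.trans_lt ENNReal.one_lt_top
  have hexp_le : ∫ z, Real.exp (h z) ∂κ ≤ 1 := by
    rw [integral_eq_lintegral_of_nonneg_ae (ae_of_all _ fun z => (Real.exp_pos _).le)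
      hmeas.exp.aestronglyMeasurable]
    simpa using ENNReal.toReal_mono ENNReal.one_ne_top hexp
  have i1 := (integrable_rnDeriv_smul_iff hac).2 hh
  have i2 : Integrable (fun z => (ρ.rnDeriv κ z).toReal • llr ρ κ z) κ :=
    (integrable_rnDeriv_smul_iff hac).2 hint
  have i3 : Integrable (fun z => (ρ.rnDeriv κ z).toReal) κ := Measure.integrable_toReal_rnDeriv
  rw [← integral_rnDeriv_smul hac, ← integral_rnDeriv_smul hac]
  have key : ∫ z, (ρ.rnDeriv κ z).toReal • h z ∂κ ≤
      ∫ z, ((ρ.rnDeriv κ z).toReal • llr ρ κ z + (Real.exp (h z) - (ρ.rnDeriv κ z).toReal)) ∂κ :=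
    integral_mono i1 (i2.add (hexp_int.sub i3)) fun z =>
      mul_le_mul_log_add_exp_sub ENNReal.toReal_nonneg _
  have i4 : Integrable (fun z => Real.exp (h z) - (ρ.rnDeriv κ z).toReal) κ := hexp_int.sub i3
  rw [integral_add i2 i4, integral_sub hexp_int i3,
    Measure.integral_toReal_rnDeriv hac] at key
  simp only [probReal_univ] at key
  linarith

theorem coe_klDiv_eq_integral [IsProbabilityMeasure ρ] [IsProbabilityMeasure κ] (hac : ρ ≪ κ)
    (hint : Integrable (llr ρ κ) ρ) :
    (InformationTheory.klDiv ρ κ : EReal) = ((∫ z, llr ρ κ z ∂ρ : ℝ) : EReal) := by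
  rw [← InformationTheory.toReal_klDiv_of_measure_eq hac (by simp)]
  exact (EReal.coe_ennreal_toReal (InformationTheory.klDiv_ne_top hac hint)).symm

/-- The form used twice: for the primal lower bound (`κ = μ ⊗ ν`) and for admissibility (`κ = ν`).
If the entropy or the cost is infinite, the right side is `⊤`, because `c ≥ m` excludes `⊤ + ⊥`. -/
theorem coe_integral_le_extIntegral_add_klDiv [IsProbabilityMeasure ρ] [IsProbabilityMeasure κ]
    {ε : ℝ} (hε : 0 < ε) {c u : Z → ℝ} (hc : Measurable c) {m : ℝ} (hm : ∀ z, m ≤ c z)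
    (humeas : Measurable u) (hu : Integrable u ρ)
    (hexp : ∫⁻ z, ENNReal.ofReal (Real.exp ((u z - c z) / ε)) ∂κ ≤ 1) :
    ((∫ z, u z ∂ρ : ℝ) : EReal) ≤
      extIntegral ρ c + (ε : EReal) * (InformationTheory.klDiv ρ κ : EReal) := by
  by_cases hkl : InformationTheory.klDiv ρ κ = ∞
  · rw [hkl, EReal.coe_ennreal_top, EReal.coe_mul_top_of_pos hε,
      EReal.add_top_of_ne_bot (extIntegral_ne_bot hm)]
    exact le_top
  obtain ⟨hac, hint⟩ := InformationTheory.klDiv_ne_top_iff.1 hkl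
  rw [coe_klDiv_eq_integral hac hint, ← EReal.coe_mul]
  by_cases hci : Integrable c ρ
  · rw [extIntegral_eq_integral hci, ← EReal.coe_add, EReal.coe_le_coe_iff]
    have h := integral_le_integral_llr hac hint (h := fun z => (u z - c z) / ε)
      ((humeas.sub hc).div_const ε) ((hu.sub hci).div_const ε) hexp
    rw [integral_div, integral_sub hu hci, div_le_iff₀ hε] at h
    linarith
  · rw [extIntegral_eq_top hc hm hci, EReal.top_add_of_ne_bot (EReal.coe_ne_bot _)]
    exact le_top

theorem integrable_withDensity_ofReal_iff {z h : Z → ℝ} (hz : Measurable z) (hz0 : ∀ p, 0 ≤ z p) :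
    Integrable h (κ.withDensity fun p => ENNReal.ofReal (z p)) ↔
      Integrable (fun p => z p * h p) κ := by
  rw [integrable_withDensity_iff_integrable_smul' hz.ennreal_ofReal (by simp)]
  simp only [ENNReal.toReal_ofReal (hz0 _), smul_eq_mul]

theorem integral_withDensity_ofReal {z : Z → ℝ} (hz : Measurable z) (hz0 : ∀ p, 0 ≤ z p)
    (h : Z → ℝ) :
    ∫ p, h p ∂(κ.withDensity fun p => ENNReal.ofReal (z p)) = ∫ p, z p * h p ∂κ := by
  rw [integral_withDensity_eq_integral_toReal_smul hz.ennreal_ofReal (by simp)]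
  simp only [ENNReal.toReal_ofReal (hz0 _), smul_eq_mul]

theorem extIntegral_add_klDiv_withDensity [IsProbabilityMeasure κ] {z c : Z → ℝ}
    (hz : Measurable z) (hz0 : ∀ p, 0 ≤ z p)
    [IsProbabilityMeasure (κ.withDensity fun p => ENNReal.ofReal (z p))]
    (hlog : Integrable (fun p => z p * Real.log (z p)) κ)
    (hcint : Integrable (fun p => z p * c p) κ) (ε : ℝ) :
    extIntegral (κ.withDensity fun p => ENNReal.ofReal (z p)) c +
      (ε : EReal) * (InformationTheory.klDiv (κ.withDensity fun p => ENNReal.ofReal (z p)) κ : EReal)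
      = ((∫ p, z p * c p ∂κ + ε * ∫ p, z p * Real.log (z p) ∂κ : ℝ) : EReal) := by
  have hac : (κ.withDensity fun p => ENNReal.ofReal (z p)) ≪ κ := withDensity_absolutelyContinuous _ _
  have hllr : llr (κ.withDensity fun p => ENNReal.ofReal (z p)) κ
      =ᵐ[κ.withDensity fun p => ENNReal.ofReal (z p)] fun p => Real.log (z p) := by
    filter_upwards [hac.ae_le (Measure.rnDeriv_withDensity κ hz.ennreal_ofReal)] with p hp
    simp only [llr_def, hp, ENNReal.toReal_ofReal (hz0 p)]
  rw [coe_klDiv_eq_integral hac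
    ((integrable_congr hllr).2 ((integrable_withDensity_ofReal_iff hz hz0).2 hlog)),
    extIntegral_eq_integral ((integrable_withDensity_ofReal_iff hz hz0).2 hcint),
    integral_congr_ae hllr, integral_withDensity_ofReal hz hz0, integral_withDensity_ofReal hz hz0,
    ← EReal.coe_mul, ← EReal.coe_add]

/-- The functional `∫ c dρ + ε H(ρ | κ)` at a Gibbs measure `dρ = exp ((u - c) / ε) dκ`. -/
theorem extIntegral_add_klDiv_gibbs [IsProbabilityMeasure κ] {ε : ℝ} (hε : 0 < ε) {c u : Z → ℝ}
    (hc : Measurable c) (hu : Measurable u)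
    [IsProbabilityMeasure (κ.withDensity fun p => ENNReal.ofReal (Real.exp ((u p - c p) / ε)))]
    (hcint : Integrable c (κ.withDensity fun p => ENNReal.ofReal (Real.exp ((u p - c p) / ε))))
    (huint : Integrable u (κ.withDensity fun p => ENNReal.ofReal (Real.exp ((u p - c p) / ε)))) :
    extIntegral (κ.withDensity fun p => ENNReal.ofReal (Real.exp ((u p - c p) / ε))) c +
      (ε : EReal) * (InformationTheory.klDiv
        (κ.withDensity fun p => ENNReal.ofReal (Real.exp ((u p - c p) / ε))) κ : EReal)
      = ((∫ p, u p ∂(κ.withDensity fun p => ENNReal.ofReal (Real.exp ((u p - c p) / ε))) : ℝ) :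
        EReal) := by
  have hz : Measurable fun p => Real.exp ((u p - c p) / ε) := ((hu.sub hc).div_const ε).exp
  have hz0 : ∀ p, 0 ≤ Real.exp ((u p - c p) / ε) := fun p => (Real.exp_pos _).le
  have hlog : Integrable (fun p => Real.exp ((u p - c p) / ε) *
      Real.log (Real.exp ((u p - c p) / ε))) κ := by
    simp only [Real.log_exp]
    exact (integrable_withDensity_ofReal_iff hz hz0).1 ((huint.sub hcint).div_const ε)
  rw [extIntegral_add_klDiv_withDensity hz hz0 hlog
    ((integrable_withDensity_ofReal_iff hz hz0).1 hcint)]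
  simp only [Real.log_exp]
  rw [← integral_withDensity_ofReal hz hz0 c, ← integral_withDensity_ofReal hz hz0,
    integral_div, integral_sub huint hcint, mul_div_cancel₀ _ hε.ne', add_sub_cancel]

end Functional

/-! ### Integration against couplings, and densities of couplings -/

section Couplings

variable {X Y : Type*} [MeasurableSpace X] [MeasurableSpace Y] {μ : Measure X} {ν : Measure Y}
  {π : Measure (X × Y)}

theorem Cpl.integrable_comp_fst (hπ : π ∈ Cpl μ ν) {h : X → ℝ} (hh : Integrable h μ) :
    Integrable (fun p : X × Y => h p.1) π := by
  rw [← hπ.2.1] at hh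
  exact hh.comp_measurable measurable_fst

theorem Cpl.integrable_comp_snd (hπ : π ∈ Cpl μ ν) {h : Y → ℝ} (hh : Integrable h ν) :
    Integrable (fun p : X × Y => h p.2) π := by
  rw [← hπ.2.2] at hh
  exact hh.comp_measurable measurable_snd

theorem Cpl.integrable_of_comp_fst (hπ : π ∈ Cpl μ ν) {h : X → ℝ} (hm : Measurable h)
    (hh : Integrable (fun p : X × Y => h p.1) π) : Integrable h μ := by
  rw [← hπ.2.1]
  exact (integrable_map_measure hm.aestronglyMeasurable measurable_fst.aemeasurable).2 hh

theorem Cpl.integrable_of_comp_snd (hπ : π ∈ Cpl μ ν) {h : Y → ℝ} (hm : Measurable h)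
    (hh : Integrable (fun p : X × Y => h p.2) π) : Integrable h ν := by
  rw [← hπ.2.2]
  exact (integrable_map_measure hm.aestronglyMeasurable measurable_snd.aemeasurable).2 hh

theorem Cpl.integral_comp_fst (hπ : π ∈ Cpl μ ν) {h : X → ℝ} (hh : Integrable h μ) :
    ∫ p, h p.1 ∂π = ∫ x, h x ∂μ := by
  obtain ⟨-, h1, -⟩ := hπ
  rw [← h1] at hh
  rw [← h1]
  exact (integral_map measurable_fst.aemeasurable hh.aestronglyMeasurable).symm

theorem Cpl.integral_comp_snd (hπ : π ∈ Cpl μ ν) {h : Y → ℝ} (hh : Integrable h ν) :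
    ∫ p, h p.2 ∂π = ∫ y, h y ∂ν := by
  obtain ⟨-, -, h1⟩ := hπ
  rw [← h1] at hh
  rw [← h1]
  exact (integral_map measurable_snd.aemeasurable hh.aestronglyMeasurable).symm

theorem Cpl.integrable_cost (hπ : π ∈ Cpl μ ν) {c : X × Y → ℝ} (hc : Measurable c) {m : ℝ}
    (hm : ∀ p, m ≤ c p) {a : X → ℝ} {b : Y → ℝ} (ha : Integrable a μ) (hb : Integrable b ν)
    (hab : ∀ x y, c (x, y) ≤ a x + b y) : Integrable c π := by
  have := hπ.1
  exact integrable_of_le_of_le hc.aestronglyMeasurable (ae_of_all _ hm)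
    (ae_of_all _ fun p => hab p.1 p.2) (integrable_const m)
    ((Cpl.integrable_comp_fst hπ ha).add (Cpl.integrable_comp_snd hπ hb))

theorem prod_mem_Cpl (μ : Measure X) [IsProbabilityMeasure μ] (ν : Measure Y)
    [IsProbabilityMeasure ν] : μ.prod ν ∈ Cpl μ ν :=
  ⟨inferInstance, Measure.fst_prod, Measure.snd_prod⟩

variable [IsProbabilityMeasure μ] [IsProbabilityMeasure ν]

/-- By Tonelli the section integral is the density of the first marginal with respect to `μ`. -/
theorem lintegral_section_eq_one_of_fst_eq {F : X × Y → ℝ≥0∞} (hF : Measurable F)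
    (h : ((μ.prod ν).withDensity F).fst = μ) : ∀ᵐ x ∂μ, ∫⁻ y, F (x, y) ∂ν = 1 := by
  refine ae_eq_of_forall_setLIntegral_eq_of_sigmaFinite hF.lintegral_prod_right'
    measurable_const fun s hs _ => ?_
  have h1 : ((μ.prod ν).withDensity F).fst s = μ s := by rw [h]
  rw [Measure.fst_apply hs, withDensity_apply _ (measurable_fst hs), ← Set.prod_univ,
    setLIntegral_prod _ hF.aemeasurable] at h1
  simpa using h1

theorem lintegral_section_eq_one_of_snd_eq {F : X × Y → ℝ≥0∞} (hF : Measurable F)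
    (h : ((μ.prod ν).withDensity F).snd = ν) : ∀ᵐ y ∂ν, ∫⁻ x, F (x, y) ∂μ = 1 := by
  refine ae_eq_of_forall_setLIntegral_eq_of_sigmaFinite hF.lintegral_prod_left'
    measurable_const fun s hs _ => ?_
  have h1 : ((μ.prod ν).withDensity F).snd s = ν s := by rw [h]
  rw [Measure.snd_apply hs, withDensity_apply _ (measurable_snd hs), ← Set.univ_prod,
    setLIntegral_prod_symm _ hF.aemeasurable] at h1
  simpa using h1

theorem withDensity_mem_Cpl {F : X × Y → ℝ≥0∞} (hF : Measurable F)
    (h1 : ∀ᵐ x ∂μ, ∫⁻ y, F (x, y) ∂ν = 1) (h2 : ∀ᵐ y ∂ν, ∫⁻ x, F (x, y) ∂μ = 1) :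
    (μ.prod ν).withDensity F ∈ Cpl μ ν := by
  have hfst : ((μ.prod ν).withDensity F).fst = μ := by
    ext s hs
    rw [Measure.fst_apply hs, withDensity_apply _ (measurable_fst hs), ← Set.prod_univ,
      setLIntegral_prod _ hF.aemeasurable]
    simp only [Measure.restrict_univ]
    rw [setLIntegral_congr_fun_ae hs (h1.mono fun x hx _ => hx)]
    simp
  have hsnd : ((μ.prod ν).withDensity F).snd = ν := by
    ext s hs
    rw [Measure.snd_apply hs, withDensity_apply _ (measurable_snd hs), ← Set.univ_prod,
      setLIntegral_prod_symm _ hF.aemeasurable]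
    simp only [Measure.restrict_univ]
    rw [setLIntegral_congr_fun_ae hs (h2.mono fun x hx _ => hx)]
    simp
  refine ⟨⟨?_⟩, hfst, hsnd⟩
  rw [← Measure.fst_univ, hfst, measure_univ]

end Couplings

/-! ### Gibbs densities: integrable potentials, primal and dual optimality -/

section Gibbs

variable {X Y : Type*} [MeasurableSpace X] [MeasurableSpace Y] {μ : Measure X} {ν : Measure Y}
  [IsProbabilityMeasure μ] [IsProbabilityMeasure ν] {π : Measure (X × Y)} {c : X × Y → ℝ}
  {f : X → ℝ} {g : Y → ℝ} {ε : ℝ}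

theorem HasGibbsDensity.eq_withDensity (hπ : π ∈ Cpl μ ν) (h : HasGibbsDensity c ε μ ν π f g) :
    π = (μ.prod ν).withDensity
      fun p => ENNReal.ofReal (Real.exp ((f p.1 + g p.2 - c p) / ε)) := by
  have := hπ.1
  rw [← Measure.withDensity_rnDeriv_eq π _ h.1]
  refine withDensity_congr_ae (h.2.mono fun p hp => ?_)
  simp only [hp, neg_add_eq_sub]

theorem hasGibbsDensity_of_eq_withDensity (hc : Measurable c) (hf : Measurable f)
    (hg : Measurable g) (h : π = (μ.prod ν).withDensity
      fun p => ENNReal.ofReal (Real.exp ((f p.1 + g p.2 - c p) / ε))) :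
    HasGibbsDensity c ε μ ν π f g := by
  refine ⟨h ▸ withDensity_absolutelyContinuous _ _, ?_⟩
  rw [h]
  filter_upwards [Measure.rnDeriv_withDensity (μ.prod ν)
    (f := fun p => ENNReal.ofReal (Real.exp ((f p.1 + g p.2 - c p) / ε))) (by fun_prop)] with p hp
  rw [hp, neg_add_eq_sub]

/-- Replacing `k` by its majorant in the normalization gives `exp ((f x - a x)/ε) * L ≤ 1`. A single
such `x` shows `L < ∞`, and taking logarithms gives `C = -ε log L`. The cost is curried so that the
lemma also bounds `g`, with the two spaces exchanged. -/
theorem exists_ae_le_add_const {k : X → Y → ℝ} (hε : 0 < ε) (hg : Measurable g) {a : X → ℝ}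
    {b : Y → ℝ} (hb : AEMeasurable b ν) (hk : ∀ x y, k x y ≤ a x + b y)
    (h : ∀ᵐ x ∂μ, ∫⁻ y, ENNReal.ofReal (Real.exp ((f x + g y - k x y) / ε)) ∂ν = 1) :
    ∃ C : ℝ, ∀ᵐ x ∂μ, f x ≤ a x + C := by
  set L : ℝ≥0∞ := ∫⁻ y, ENNReal.ofReal (Real.exp ((g y - b y) / ε)) ∂ν with hL
  have hL0 : L ≠ 0 := by
    rw [hL, Ne, lintegral_eq_zero_iff' (by fun_prop)]
    intro h0
    obtain ⟨y, hy⟩ := h0.exists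
    simp only [Pi.zero_apply, ENNReal.ofReal_eq_zero] at hy
    exact absurd (Real.exp_pos _) hy.not_gt
  have hle : ∀ᵐ x ∂μ, ENNReal.ofReal (Real.exp ((f x - a x) / ε)) * L ≤ 1 := by
    filter_upwards [h] with x hx
    refine (lintegral_const_mul_le _ _).trans (le_of_le_of_eq (lintegral_mono fun y => ?_) hx)
    rw [← ENNReal.ofReal_mul (Real.exp_pos _).le, ← Real.exp_add, ← add_div]
    have := hk x y
    gcongr
    linarith
  have hLt : L ≠ ∞ := by
    rintro hLt
    obtain ⟨x, hx⟩ := hle.exists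
    rw [hLt, ENNReal.mul_top (by simpa using Real.exp_pos _)] at hx
    exact absurd hx (by simp)
  refine ⟨-(ε * Real.log L.toReal), hle.mono fun x hx => ?_⟩
  have hLpos : 0 < L.toReal := ENNReal.toReal_pos hL0 hLt
  have hx' := ENNReal.toReal_mono ENNReal.one_ne_top hx
  rw [ENNReal.toReal_mul, ENNReal.toReal_ofReal (Real.exp_pos _).le, ENNReal.toReal_one] at hx'
  have hlog := Real.log_le_log (by positivity) hx'
  rw [Real.log_mul (Real.exp_pos _).ne' hLpos.ne', Real.log_exp, Real.log_one] at hlog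
  have : (f x - a x) / ε ≤ -Real.log L.toReal := by linarith
  rw [div_le_iff₀ hε] at this
  linarith

/-- The function `exp t * min t 0` takes values in `[-1, 0]`. -/
theorem integrable_min_zero_withDensity_exp {Z : Type*} [MeasurableSpace Z] {κ : Measure Z}
    [IsFiniteMeasure κ] {φ : Z → ℝ} (hφ : Measurable φ) :
    Integrable (fun z => min (φ z) 0) (κ.withDensity fun z => ENNReal.ofReal (Real.exp (φ z))) := by
  rw [integrable_withDensity_ofReal_iff hφ.exp fun z => (Real.exp_pos _).le]
  refine integrable_of_le_of_le (by fun_prop) (ae_of_all _ fun z => ?_) (ae_of_all _ fun z => ?_)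
    (integrable_const (-1)) (integrable_const 0)
  · rcases le_total (φ z) 0 with h | h
    · simp only [min_eq_left h]
      have := mul_le_mul_log_add_exp_sub (Real.exp_pos (φ z)).le 0
      rw [Real.log_exp, Real.exp_zero] at this
      have := Real.exp_pos (φ z)
      nlinarith
    · simp [min_eq_right h]
  · exact mul_nonpos_of_nonneg_of_nonpos (Real.exp_pos _).le (min_le_right _ _)

/-- Potentials of a Gibbs density are integrable: they are bounded above by integrable functions
through the normalization of the sections, and `f ⊕ g` is bounded below by an integrable function
because `t log t` is bounded below. -/
theorem HasGibbsDensity.integrable_potentials (hε : 0 < ε) (hπ : π ∈ Cpl μ ν) (hc : Measurable c)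
    {m : ℝ} (hm : ∀ p, m ≤ c p) {a : X → ℝ} {b : Y → ℝ} (ha : Integrable a μ)
    (hb : Integrable b ν) (hab : ∀ x y, c (x, y) ≤ a x + b y) (hf : Measurable f)
    (hg : Measurable g) (h : HasGibbsDensity c ε μ ν π f g) :
    Integrable f μ ∧ Integrable g ν := by
  have := hπ.1
  have hπeq := h.eq_withDensity hπ
  have hF : Measurable fun p : X × Y =>
    ENNReal.ofReal (Real.exp ((f p.1 + g p.2 - c p) / ε)) := by fun_prop
  obtain ⟨A, hA⟩ := exists_ae_le_add_const hε hg hb.aemeasurable hab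
    (lintegral_section_eq_one_of_fst_eq hF (hπeq ▸ hπ.2.1))
  obtain ⟨B, hB⟩ := exists_ae_le_add_const (μ := ν) (ν := μ) (f := g) (g := f)
    (k := fun y x => c (x, y)) hε hf ha.aemeasurable (fun y x => (hab x y).trans_eq (add_comm _ _))
    (by simpa only [add_comm] using lintegral_section_eq_one_of_snd_eq hF (hπeq ▸ hπ.2.2))
  have hA' : ∀ᵐ p ∂π, f p.1 ≤ a p.1 + A := by
    rw [← hπ.2.1] at hA
    exact ae_of_ae_map measurable_fst.aemeasurable hA
  have hB' : ∀ᵐ p ∂π, g p.2 ≤ b p.2 + B := by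
    rw [← hπ.2.2] at hB
    exact ae_of_ae_map measurable_snd.aemeasurable hB
  have hmin : Integrable (fun p => min ((f p.1 + g p.2 - c p) / ε) 0) π := by
    have := integrable_min_zero_withDensity_exp (κ := μ.prod ν)
      (φ := fun p => (f p.1 + g p.2 - c p) / ε) (by fun_prop)
    rwa [← hπeq] at this
  have hlow : ∀ p : X × Y, ε * min ((f p.1 + g p.2 - c p) / ε) 0 + m ≤ f p.1 + g p.2 := fun p => by
    have h1 := mul_le_mul_of_nonneg_left (min_le_left ((f p.1 + g p.2 - c p) / ε) 0) hε.le
    rw [mul_div_cancel₀ _ hε.ne'] at h1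
    linarith [hm p]
  have iA : Integrable (fun p : X × Y => a p.1 + A) π :=
    (Cpl.integrable_comp_fst hπ ha).add (integrable_const A)
  have iB : Integrable (fun p : X × Y => b p.2 + B) π :=
    (Cpl.integrable_comp_snd hπ hb).add (integrable_const B)
  have iL : Integrable (fun p : X × Y => ε * min ((f p.1 + g p.2 - c p) / ε) 0 + m) π :=
    (hmin.const_mul ε).add (integrable_const m)
  constructor
  -- The lower bound on `f ⊕ g` minus the upper bound on `g` is an integrable minorant of `f`.
  · refine Cpl.integrable_of_comp_fst hπ hf
      (integrable_of_le_of_le (hf.comp measurable_fst).aestronglyMeasurable ?_ hA'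
      (iL.sub iB) iA)
    filter_upwards [hB'] with p hp
    simp only [Pi.sub_apply]
    linarith [hlow p]
  · refine Cpl.integrable_of_comp_snd hπ hg
      (integrable_of_le_of_le (hg.comp measurable_snd).aestronglyMeasurable ?_ hB'
      (iL.sub iA) iB)
    filter_upwards [hA'] with p hp
    simp only [Pi.sub_apply]
    linarith [hlow p]

/-- The integral of `f ⊕ g` is the same for all couplings, so the Gibbs inequality gives one lower
bound for all of them; its normalization condition is that `π` has mass one. -/
theorem HasGibbsDensity.isPrimalOptimal (hε : 0 < ε) (hπ : π ∈ Cpl μ ν) (hc : Measurable c)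
    {m : ℝ} (hm : ∀ p, m ≤ c p) (hcint : Integrable c π) (hf : Measurable f) (hg : Measurable g)
    (hfi : Integrable f μ) (hgi : Integrable g ν) (h : HasGibbsDensity c ε μ ν π f g) :
    IsPrimalOptimal c ε μ ν π := by
  have hπeq := h.eq_withDensity hπ
  have hint : ∀ {ρ : Measure (X × Y)}, ρ ∈ Cpl μ ν →
      Integrable (fun p : X × Y => f p.1 + g p.2) ρ ∧
        ∫ p, (f p.1 + g p.2) ∂ρ = ∫ x, f x ∂μ + ∫ y, g y ∂ν := fun {ρ} hρ => by
    have h1 := Cpl.integrable_comp_fst hρ hfi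
    have h2 := Cpl.integrable_comp_snd hρ hgi
    exact ⟨h1.add h2, by rw [integral_add h1 h2, Cpl.integral_comp_fst hρ hfi, Cpl.integral_comp_snd hρ hgi]⟩
  have hval : entropicCost c ε μ ν π = ((∫ x, f x ∂μ + ∫ y, g y ∂ν : ℝ) : EReal) := by
    have := hπ.1
    have hi := hint hπ
    rw [← hi.2]
    replace hi := hi.1
    rw [entropicCost]
    subst hπeq
    exact extIntegral_add_klDiv_gibbs (u := fun p : X × Y => f p.1 + g p.2) hε hc (by fun_prop)
      hcint hi
  refine ⟨hπ, le_antisymm (le_iInf₂ fun ρ hρ => ?_) (iInf₂_le π hπ)⟩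
  have := hρ.1
  rw [hval, ← (hint hρ).2]
  refine coe_integral_le_extIntegral_add_klDiv hε hc hm (by fun_prop) (hint hρ).1 ?_
  rw [← setLIntegral_univ, ← withDensity_apply _ .univ, ← hπeq]
  exact hπ.1.measure_univ.le

/-- The constraint at `x` is tested with the conditional law `z(x, ·) ν` of `π`, where the weak cost
equals `f x` plus the integral of `g`. Integrating over `μ` turns the conditional integrals of `ψ`
and `g` into integrals over `ν`. -/
theorem HasGibbsDensity.dualObjective_le (hε : 0 < ε) (hπ : π ∈ Cpl μ ν) (hc : Measurable c)
    (hcint : Integrable c π) (hf : Measurable f) (hg : Measurable g)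
    (hfi : Integrable f μ) (hgi : Integrable g ν) (h : HasGibbsDensity c ε μ ν π f g)
    {φ : X → EReal} {ψ : Y → EReal} (hadm : IsDualAdmissible c ε μ ν φ ψ) :
    integralL1 μ φ + integralL1 ν ψ ≤ ∫ x, f x ∂μ + ∫ y, g y ∂ν := by
  have hπeq := h.eq_withDensity hπ
  set z : X × Y → ℝ := fun p => Real.exp ((f p.1 + g p.2 - c p) / ε) with hz_def
  have hz : Measurable z := by fun_prop
  have hz0 : ∀ p, 0 ≤ z p := fun p => (Real.exp_pos _).le
  have hsec := lintegral_section_eq_one_of_fst_eq hz.ennreal_ofReal (hπeq ▸ hπ.2.1)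
  have hint : ∀ {k : X × Y → ℝ}, Integrable k π → Integrable (fun p => z p * k p) (μ.prod ν) :=
    fun {k} hk => by
      rw [hπeq] at hk
      exact (integrable_withDensity_ofReal_iff hz hz0).1 hk
  have hfub : ∀ {k : Y → ℝ}, Integrable k ν →
      ∫ x, ∫ y, z (x, y) * k y ∂ν ∂μ = ∫ y, k y ∂ν := fun {k} hk => by
    have hk' := Cpl.integrable_comp_snd hπ hk
    rw [← Cpl.integral_comp_snd hπ hk, hπeq, integral_withDensity_ofReal hz hz0,
      integral_prod _ (hint hk')]
  have hψ := hint (Cpl.integrable_comp_snd hπ hadm.right.integrable)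
  have hg' := hint (Cpl.integrable_comp_snd hπ hgi)
  have key : ∀ᵐ x ∂μ, (φ x).toReal + ∫ y, z (x, y) * (ψ y).toReal ∂ν ≤
      f x + ∫ y, z (x, y) * g y ∂ν := by
    filter_upwards [hsec, hψ.prod_right_ae, hg'.prod_right_ae, (hint hcint).prod_right_ae,
      hadm.left.ae_ne_bot] with x h1 h2 h3 h4 h5
    have hzx : Measurable fun y => z (x, y) := hz.comp measurable_prodMk_left
    have hzx0 : ∀ y, 0 ≤ z (x, y) := fun y => hz0 _
    have : IsProbabilityMeasure (ν.withDensity fun y => ENNReal.ofReal (z (x, y))) :=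
      ⟨by rw [withDensity_apply _ .univ, setLIntegral_univ, h1]⟩
    have hL : IsL1 (ν.withDensity fun y => ENNReal.ofReal (z (x, y))) ψ :=
      ⟨hadm.right.measurable, hadm.right.ne_top,
        (withDensity_absolutelyContinuous _ _).ae_le hadm.right.ae_ne_bot,
        (integrable_withDensity_ofReal_iff hzx hzx0).2 h2⟩
    have hgx : Integrable g (ν.withDensity fun y => ENNReal.ofReal (z (x, y))) :=
      (integrable_withDensity_ofReal_iff hzx hzx0).2 h3
    have hle := hadm.le x _ inferInstance hL
    have hval := extIntegral_add_klDiv_gibbs (κ := ν) (c := fun y => c (x, y))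
      (u := fun y => f x + g y) hε (hc.comp measurable_prodMk_left) (by fun_prop)
      ((integrable_withDensity_ofReal_iff hzx hzx0).2 h4) ((integrable_const (f x)).add hgx)
    rw [weakCost, hval, ← EReal.coe_toReal (hadm.left.ne_top x) h5, ← EReal.coe_add,
      EReal.coe_le_coe_iff, integralL1, integral_withDensity_ofReal hzx hzx0] at hle
    refine hle.trans_eq ?_
    have := integral_withDensity_ofReal (κ := ν) hzx hzx0 g
    rw [← this]
    refine (integral_add (integrable_const (f x)) hgx).trans ?_
    rw [integral_const, probReal_univ, one_smul]
  have h1 := hψ.integral_prod_left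
  have h2 := hg'.integral_prod_left
  have := integral_mono_ae (hadm.left.integrable.add h1) (hfi.add h2) key
  rw [integral_add' hadm.left.integrable h1, integral_add' hfi h2,
    hfub hadm.right.integrable, hfub hgi] at this
  exact this

theorem HasGibbsDensity.exists_isDualOptimal (hε : 0 < ε) (hπ : π ∈ Cpl μ ν) (hc : Measurable c)
    {m : ℝ} (hm : ∀ p, m ≤ c p) (hcint : Integrable c π) (hf : Measurable f) (hg : Measurable g)
    (hfi : Integrable f μ) (hgi : Integrable g ν) (h : HasGibbsDensity c ε μ ν π f g) :
    ∃ f' : X → EReal, (∀ᵐ x ∂μ, f' x = (f x : EReal)) ∧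
      IsDualOptimal c ε μ ν f' (fun y => (g y : EReal)) := by
  have hπeq := h.eq_withDensity hπ
  have hF : Measurable fun p : X × Y =>
    ENNReal.ofReal (Real.exp ((f p.1 + g p.2 - c p) / ε)) := by fun_prop
  set s : Set X :=
    {x | ∫⁻ y, ENNReal.ofReal (Real.exp ((f x + g y - c (x, y)) / ε)) ∂ν ≤ 1} with hs_def
  have hs : MeasurableSet s := measurableSet_le hF.lintegral_prod_right' measurable_const
  have hsec : ∀ᵐ x ∂μ, x ∈ s :=
    (lintegral_section_eq_one_of_fst_eq hF (hπeq ▸ hπ.2.1)).mono fun x hx => hx.le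
  classical
  -- The constraint must hold at every `x`, but the marginals control the section mass only a.e.;
  -- the value `⊥` makes the constraint trivial at the remaining points.
  set f' : X → EReal := s.piecewise (fun x => (f x : EReal)) fun _ => ⊥ with hf'_def
  have hf' : ∀ᵐ x ∂μ, f' x = (f x : EReal) :=
    hsec.mono fun x hx => Set.piecewise_eq_of_mem _ _ _ hx
  have hf'r : (fun x => (f' x).toReal) =ᵐ[μ] f := hf'.mono fun x hx => by simp [hx]
  have hadm : IsDualAdmissible c ε μ ν f' fun y => (g y : EReal) := by
    refine ⟨⟨?_, fun x => ?_, hf'.mono fun x hx => by simp [hx], (integrable_congr hf'r).2 hfi⟩,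
      ⟨hg.coe_real_ereal, fun y => EReal.coe_ne_top _, ae_of_all _ fun y => EReal.coe_ne_bot _,
        by simpa using hgi⟩, fun x ρ hρ hL => ?_⟩
    · exact Measurable.piecewise hs hf.coe_real_ereal measurable_const
    · by_cases hx : x ∈ s <;> simp [hf'_def, hx]
    · by_cases hx : x ∈ s
      · have hgρ : Integrable g ρ := by simpa using hL.integrable
        have := coe_integral_le_extIntegral_add_klDiv (ρ := ρ) (κ := ν) (c := fun y => c (x, y))
          (u := fun y => f x + g y) hε (hc.comp measurable_prodMk_left) (fun y => hm (x, y))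
          (by fun_prop) ((integrable_const (f x)).add hgρ) hx
        rw [integral_add (integrable_const _) hgρ, integral_const, probReal_univ, one_smul] at this
        simpa [hf'_def, hx, integralL1, weakCost] using this
      · simp [hf'_def, hx]
  refine ⟨f', hf', hadm, le_antisymm (le_iSup₂_of_le f' _ (le_iSup_of_le hadm le_rfl))
    (iSup₂_le fun φ ψ => iSup_le fun hφψ => ?_)⟩
  rw [dualObjective, dualObjective, EReal.coe_le_coe_iff]
  refine (h.dualObjective_le hε hπ hc hcint hf hg hfi hgi hφψ).trans_eq ?_
  rw [integralL1, integralL1, integral_congr_ae hf'r]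
  simp

end Gibbs

/-! ### Variations of an optimal density -/

section Optimality

variable {X Y : Type*} [MeasurableSpace X] [MeasurableSpace Y] {μ : Measure X} {ν : Measure Y}
  [IsProbabilityMeasure μ] [IsProbabilityMeasure ν] {c z k : X × Y → ℝ} {ε : ℝ}

theorem lintegral_ofReal_eq_one_iff {Z : Type*} [MeasurableSpace Z] {κ : Measure Z} {h : Z → ℝ}
    (hh : Measurable h) (h0 : ∀ p, 0 ≤ h p) :
    ∫⁻ p, ENNReal.ofReal (h p) ∂κ = 1 ↔ ∫ p, h p ∂κ = 1 := by
  rw [integral_eq_lintegral_of_nonneg_ae (ae_of_all _ h0) hh.aestronglyMeasurable,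
    ENNReal.toReal_eq_one_iff]

/-- `z` is a density with respect to `μ ⊗ ν` whose sections have mass one. -/
structure IsCouplingDensity (μ : Measure X) (ν : Measure Y) (z : X × Y → ℝ) : Prop where
  measurable : Measurable z
  nonneg : ∀ p, 0 ≤ z p
  integrable : Integrable z (μ.prod ν)
  integral_right : ∀ᵐ x ∂μ, ∫ y, z (x, y) ∂ν = 1
  integral_left : ∀ᵐ y ∂ν, ∫ x, z (x, y) ∂μ = 1

theorem isCouplingDensity_iff (hz : Measurable z) (hz0 : ∀ p, 0 ≤ z p) :
    IsCouplingDensity μ ν z ↔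
      (μ.prod ν).withDensity (fun p => ENNReal.ofReal (z p)) ∈ Cpl μ ν := by
  have h1 : ∀ x, ∫⁻ y, ENNReal.ofReal (z (x, y)) ∂ν = 1 ↔ ∫ y, z (x, y) ∂ν = 1 := fun x =>
    lintegral_ofReal_eq_one_iff (hz.comp measurable_prodMk_left) fun _ => hz0 _
  have h2 : ∀ y, ∫⁻ x, ENNReal.ofReal (z (x, y)) ∂μ = 1 ↔ ∫ x, z (x, y) ∂μ = 1 := fun y =>
    lintegral_ofReal_eq_one_iff (hz.comp measurable_prodMk_right) fun _ => hz0 _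
  constructor
  · intro h
    exact withDensity_mem_Cpl hz.ennreal_ofReal (by simpa only [h1] using h.integral_right)
      (by simpa only [h2] using h.integral_left)
  · intro h
    refine ⟨hz, hz0, ?_, ?_, ?_⟩
    · have := h.1
      simpa using (integrable_withDensity_ofReal_iff hz hz0).1 (integrable_const (1 : ℝ))
    · simpa only [h1] using lintegral_section_eq_one_of_fst_eq hz.ennreal_ofReal h.2.1
    · simpa only [h2] using lintegral_section_eq_one_of_snd_eq hz.ennreal_ofReal h.2.2

theorem neg_one_le_mul_log {p : ℝ} (hp : 0 ≤ p) : -1 ≤ p * Real.log p := by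
  have := mul_le_mul_log_add_exp_sub hp 0
  rw [Real.exp_zero] at this
  linarith

theorem integrable_mul_log_of_le {Z : Type*} [MeasurableSpace Z] {κ : Measure Z}
    [IsFiniteMeasure κ] {h b : Z → ℝ} (hm : Measurable h) (h0 : ∀ p, 0 ≤ h p)
    (hb : Integrable b κ) (hle : ∀ p, h p * Real.log (h p) ≤ b p) :
    Integrable (fun p => h p * Real.log (h p)) κ :=
  integrable_of_le_of_le (by fun_prop) (ae_of_all _ fun p => neg_one_le_mul_log (h0 p))
    (ae_of_all _ hle) (integrable_const (-1)) hb

/-- `z` minimizes the primal functional, in real form, over coupling densities of finite entropy. -/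
structure IsOptimalDensity (c : X × Y → ℝ) (ε : ℝ) (μ : Measure X) (ν : Measure Y)
    (z : X × Y → ℝ) : Prop extends IsCouplingDensity μ ν z where
  integrable_mul_log : Integrable (fun p => z p * Real.log (z p)) (μ.prod ν)
  le_of_isCouplingDensity : ∀ z', IsCouplingDensity μ ν z' →
    Integrable (fun p => z' p * Real.log (z' p)) (μ.prod ν) →
      ∫ p, z p * c p ∂(μ.prod ν) + ε * ∫ p, z p * Real.log (z p) ∂(μ.prod ν) ≤
        ∫ p, z' p * c p ∂(μ.prod ν) + ε * ∫ p, z' p * Real.log (z' p) ∂(μ.prod ν)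

theorem IsCouplingDensity.integrable_mul (hz : IsCouplingDensity μ ν z)
    (hcint : ∀ ρ ∈ Cpl μ ν, Integrable c ρ) : Integrable (fun p => z p * c p) (μ.prod ν) :=
  (integrable_withDensity_ofReal_iff hz.measurable hz.nonneg).1
    (hcint _ ((isCouplingDensity_iff hz.measurable hz.nonneg).1 hz))

/-- The product coupling has finite cost, so an optimizer has finite entropy and therefore a
density. -/
theorem IsPrimalOptimal.exists_isOptimalDensity (hε : 0 < ε) {m : ℝ} (hm : ∀ p, m ≤ c p)
    (hcint : ∀ ρ ∈ Cpl μ ν, Integrable c ρ) {π : Measure (X × Y)}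
    (h : IsPrimalOptimal c ε μ ν π) :
    ∃ z, IsOptimalDensity c ε μ ν z ∧
      π = (μ.prod ν).withDensity fun p => ENNReal.ofReal (z p) := by
  have hπ := h.1.1
  have hle : ∀ ρ ∈ Cpl μ ν, entropicCost c ε μ ν π ≤ entropicCost c ε μ ν ρ := fun ρ hρ =>
    h.2.trans_le (iInf₂_le ρ hρ)
  have hkl : InformationTheory.klDiv π (μ.prod ν) ≠ ∞ := by
    intro hkl
    have h1 := hle _ (prod_mem_Cpl μ ν)
    rw [entropicCost, entropicCost, hkl, EReal.coe_ennreal_top, EReal.coe_mul_top_of_pos hε,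
      EReal.add_top_of_ne_bot (extIntegral_ne_bot hm), InformationTheory.klDiv_self,
      extIntegral_eq_integral (hcint _ (prod_mem_Cpl μ ν)), EReal.coe_ennreal_zero, mul_zero,
      add_zero, top_le_iff] at h1
    exact EReal.coe_ne_top _ h1
  obtain ⟨hac, hint⟩ := InformationTheory.klDiv_ne_top_iff.1 hkl
  have hπeq : π = (μ.prod ν).withDensity
      fun p => ENNReal.ofReal (π.rnDeriv (μ.prod ν) p).toReal := by
    conv_lhs => rw [← Measure.withDensity_rnDeriv_eq π _ hac]
    refine withDensity_congr_ae ?_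
    filter_upwards [Measure.rnDeriv_lt_top π (μ.prod ν)] with p hp
    rw [ENNReal.ofReal_toReal hp.ne]
  have hz : Measurable fun p => (π.rnDeriv (μ.prod ν) p).toReal := by fun_prop
  have hz0 : ∀ p, 0 ≤ (π.rnDeriv (μ.prod ν) p).toReal := fun p => ENNReal.toReal_nonneg
  have hlog : Integrable (fun p => (π.rnDeriv (μ.prod ν) p).toReal *
      Real.log (π.rnDeriv (μ.prod ν) p).toReal) (μ.prod ν) :=
    (integrable_rnDeriv_smul_iff hac).2 hint
  have hcost : ∀ {z' : X × Y → ℝ}, IsCouplingDensity μ ν z' →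
      Integrable (fun p => z' p * Real.log (z' p)) (μ.prod ν) →
      entropicCost c ε μ ν ((μ.prod ν).withDensity fun p => ENNReal.ofReal (z' p)) =
        ((∫ p, z' p * c p ∂(μ.prod ν) + ε * ∫ p, z' p * Real.log (z' p) ∂(μ.prod ν) : ℝ) :
          EReal) := fun {z'} hz' hlog' => by
    have := ((isCouplingDensity_iff hz'.measurable hz'.nonneg).1 hz').1
    exact extIntegral_add_klDiv_withDensity hz'.measurable hz'.nonneg hlog'
      (hz'.integrable_mul hcint) ε
  have hdens := (isCouplingDensity_iff hz hz0).2 (hπeq ▸ h.1)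
  refine ⟨_, ⟨hdens, hlog, fun z' hz' hlog' => ?_⟩, hπeq⟩
  rw [← EReal.coe_le_coe_iff, ← hcost hz' hlog', ← hcost hdens hlog, ← hπeq]
  exact hle _ ((isCouplingDensity_iff hz'.measurable hz'.nonneg).1 hz')

/-- Convexity between `p` and `1`, where `t log t` vanishes; at `p = 0` the exact value keeps the
term `t log t` that drives the positivity argument. -/
theorem convexComb_mul_log_le {t p : ℝ} (ht0 : 0 < t) (ht1 : t < 1) (hp : 0 ≤ p) :
    ((1 - t) * p + t) * Real.log ((1 - t) * p + t) ≤
      (1 - t) * (p * Real.log p) + (if p = 0 then t * Real.log t else 0) := by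
  split_ifs with h0
  · simp [h0]
  · have := Real.convexOn_mul_log.2 (Set.mem_Ici.2 hp) (Set.mem_Ici.2 zero_le_one)
      (sub_nonneg.2 ht1.le) ht0.le (sub_add_cancel 1 t)
    simpa using this

/-- An optimal density is positive: mixing with `μ ⊗ ν` would otherwise decrease the entropy at
infinite rate. -/
theorem IsOptimalDensity.ae_pos (hε : 0 < ε) (hcint : ∀ ρ ∈ Cpl μ ν, Integrable c ρ)
    (h : IsOptimalDensity c ε μ ν z) : ∀ᵐ p ∂(μ.prod ν), 0 < z p := by
  set κ := μ.prod ν with hκ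
  set A : Set (X × Y) := {p | z p = 0} with hA_def
  have hA : MeasurableSet A := h.measurable (measurableSet_singleton 0)
  have hzc : Integrable (fun p => z p * c p) κ := h.toIsCouplingDensity.integrable_mul hcint
  have hc : Integrable c κ := hcint _ (prod_mem_Cpl μ ν)
  set J := ∫ p, z p * c p ∂κ + ε * ∫ p, z p * Real.log (z p) ∂κ with hJ
  -- Optimality against the mixture `(1 - t) z + t`, divided by `t`; if `A` had positive mass, the
  -- right side would tend to `-∞` as `t → 0`.
  have key : ∀ t : ℝ, 0 < t → t < 1 → J ≤ ∫ p, c p ∂κ + ε * (Real.log t * κ.real A) := by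
    intro t ht0 ht1
    have hm' : Measurable fun p => (1 - t) * z p + t := (h.measurable.const_mul _).add_const _
    have h0' : ∀ p, 0 ≤ (1 - t) * z p + t := fun p =>
      add_nonneg (mul_nonneg (by linarith) (h.nonneg p)) ht0.le
    have hdens : IsCouplingDensity μ ν fun p => (1 - t) * z p + t := by
      refine ⟨hm', h0', (h.integrable.const_mul _).add (integrable_const _), ?_, ?_⟩
      · filter_upwards [h.integral_right, h.integrable.prod_right_ae] with x hx hxi
        rw [integral_add (hxi.const_mul _) (integrable_const _), integral_const_mul, hx]
        simp
      · filter_upwards [h.integral_left, h.integrable.prod_left_ae] with y hy hyi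
        rw [integral_add (hyi.const_mul _) (integrable_const _), integral_const_mul, hy]
        simp
    have hind : Integrable (A.indicator fun _ => t * Real.log t) κ :=
      (integrable_const _).indicator hA
    have hle : ∀ p, ((1 - t) * z p + t) * Real.log ((1 - t) * z p + t) ≤
        (1 - t) * (z p * Real.log (z p)) + A.indicator (fun _ => t * Real.log t) p := fun p => by
      simpa only [Set.indicator_apply, hA_def, Set.mem_ofPred_eq] using
        convexComb_mul_log_le ht0 ht1 (h.nonneg p)
    have hbd := (h.integrable_mul_log.const_mul (1 - t)).add hind
    have hlog := integrable_mul_log_of_le hm' h0' hbd hle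
    have h1 := h.le_of_isCouplingDensity _ hdens hlog
    have h2 := integral_mono hlog hbd hle
    rw [integral_add' (h.integrable_mul_log.const_mul (1 - t)) hind, integral_const_mul,
      integral_indicator_const _ hA, smul_eq_mul] at h2
    have h3 : ∫ p, ((1 - t) * z p + t) * c p ∂κ = (1 - t) * ∫ p, z p * c p ∂κ + t * ∫ p, c p ∂κ := by
      rw [← integral_const_mul, ← integral_const_mul,
        ← integral_add (hzc.const_mul _) (hc.const_mul _)]
      congr with p
      ring
    rw [h3] at h1
    have h4 := mul_le_mul_of_nonneg_left h2 hε.le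
    refine le_of_mul_le_mul_left ?_ ht0
    rw [hJ]
    nlinarith
  have hA0 : κ.real A = 0 := by
    by_contra hne
    have hpos : 0 < κ.real A := lt_of_le_of_ne measureReal_nonneg (Ne.symm hne)
    -- With `t = exp (-s)` the entropy term is `-(|∫ c - J| + 1)`, which contradicts `key`.
    set s := (|∫ p, c p ∂κ - J| + 1) / (ε * κ.real A) with hs
    have hs0 : 0 < s := by positivity
    have h1 := key (Real.exp (-s)) (Real.exp_pos _) (by simpa using hs0)
    rw [Real.log_exp] at h1
    have h2 : s * (ε * κ.real A) = |∫ p, c p ∂κ - J| + 1 := div_mul_cancel₀ _ (by positivity)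
    have h3 := neg_abs_le (∫ p, c p ∂κ - J)
    nlinarith [le_abs_self (∫ p, c p ∂κ - J)]
  rw [measureReal_eq_zero_iff] at hA0
  filter_upwards [measure_eq_zero_iff_ae_notMem.1 hA0] with p hp
  exact lt_of_le_of_ne (h.nonneg p) (Ne.symm hp)

/-- First-order expansion with explicit remainder, from `log (1 + s/p) ≤ s/p`. It replaces
differentiation under the integral. -/
theorem add_mul_log_add_le {p s : ℝ} (hp : 0 < p) (hs : 0 ≤ p + s) :
    (p + s) * Real.log (p + s) ≤ p * Real.log p + s * (Real.log p + 1) + s ^ 2 / p := by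
  have h : p * Real.log p + s * (Real.log p + 1) + s ^ 2 / p
      = (p + s) * (Real.log p + s / p) := by
    field_simp
    ring
  rw [h]
  rcases hs.eq_or_lt with h0 | h0
  · simp [← h0]
  · refine mul_le_mul_of_nonneg_left ?_ hs
    have h1 := Real.log_le_sub_one_of_pos (div_pos h0 hp)
    rw [Real.log_div h0.ne' hp.ne', add_div, div_self hp.ne'] at h1
    linarith

/-- First-order optimality condition along a bounded direction `k` with vanishing marginals that is
supported where `z` is bounded away from zero. -/
theorem IsOptimalDensity.integral_mul_nonneg (hε : 0 < ε)
    (hcint : ∀ ρ ∈ Cpl μ ν, Integrable c ρ) (h : IsOptimalDensity c ε μ ν z) {δ : ℝ} (hδ : 0 < δ)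
    (hk : Measurable k) (hk1 : ∀ p, |k p| ≤ 1) (hsupp : ∀ p, z p < δ → k p = 0)
    (hr : ∀ x, ∫ y, k (x, y) ∂ν = 0) (hl : ∀ y, ∫ x, k (x, y) ∂μ = 0)
    (hki : Integrable (fun p => k p * (c p + ε * Real.log (z p))) (μ.prod ν)) :
    0 ≤ ∫ p, k p * (c p + ε * Real.log (z p)) ∂(μ.prod ν) := by
  set κ := μ.prod ν with hκ
  have hzc : Integrable (fun p => z p * c p) κ := h.toIsCouplingDensity.integrable_mul hcint
  have hc : Integrable c κ := hcint _ (prod_mem_Cpl μ ν)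
  have hkint : Integrable k κ := Integrable.of_bound hk.aestronglyMeasurable 1 (ae_of_all _ hk1)
  have hk0 : ∫ p, k p ∂κ = 0 := by
    rw [hκ, integral_prod _ hkint]
    simp [hr]
  have hkc : Integrable (fun p => k p * c p) κ :=
    hc.bdd_mul hk.aestronglyMeasurable (ae_of_all _ hk1)
  have hklog : Integrable (fun p => k p * (Real.log (z p) + 1)) κ := by
    have h1 := ((hki.sub hkc).const_mul ε⁻¹).add hkint
    refine h1.congr (ae_of_all _ fun p => ?_)
    simp only [Pi.add_apply, Pi.sub_apply]
    field_simp
    ring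
  set I := ∫ p, k p * (c p + ε * Real.log (z p)) ∂κ with hI
  -- Since `∫ k = 0`, `log z` may be replaced by `log z + 1`, the derivative of `z log z`.
  have hIeq : I = ∫ p, k p * c p ∂κ + ε * ∫ p, k p * (Real.log (z p) + 1) ∂κ := by
    have h1 : ∫ p, k p * (Real.log (z p) + 1) ∂κ =
        ∫ p, (k p * (Real.log (z p) + 1) - k p) ∂κ := by
      rw [integral_sub hklog hkint, hk0, sub_zero]
    have h2 : Integrable (fun p => ε * (k p * (Real.log (z p) + 1) - k p)) κ :=
      (hklog.sub hkint).const_mul ε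
    rw [h1, ← integral_const_mul, ← integral_add hkc h2, hI]
    congr with p
    ring
  have key : ∀ s : ℝ, 0 < s → s ≤ 1 → 0 ≤ I + ε * s := by
    intro s hs0 hs1
    -- On `{z ≥ δ}`, `t ≤ δ` keeps `z + t k` nonnegative, and the remainder `(t k)² / z` is at most
    -- `t² / δ = t s`.
    set t := δ * s with ht
    have ht0 : 0 < t := mul_pos hδ hs0
    have htδ : t ≤ δ := mul_le_of_le_one_right hδ.le hs1
    have hm' : Measurable fun p => z p + t * k p := h.measurable.add (hk.const_mul t)
    have h0' : ∀ p, 0 ≤ z p + t * k p := fun p => by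
      by_cases hp : z p < δ
      · simpa [hsupp p hp] using h.nonneg p
      · have := (abs_le.1 (hk1 p)).1
        nlinarith
    have hdens : IsCouplingDensity μ ν fun p => z p + t * k p := by
      refine ⟨hm', h0', h.integrable.add (hkint.const_mul t), ?_, ?_⟩
      · filter_upwards [h.integral_right, h.integrable.prod_right_ae,
          hkint.prod_right_ae] with x hx hxi hki
        rw [integral_add hxi (hki.const_mul _), integral_const_mul, hx, hr, mul_zero, add_zero]
      · filter_upwards [h.integral_left, h.integrable.prod_left_ae,
          hkint.prod_left_ae] with y hy hyi hki
        rw [integral_add hyi (hki.const_mul _), integral_const_mul, hy, hl, mul_zero, add_zero]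
    have hle : ∀ p, (z p + t * k p) * Real.log (z p + t * k p) ≤
        z p * Real.log (z p) + t * (k p * (Real.log (z p) + 1)) + t * s := fun p => by
      by_cases hp : z p < δ
      · simpa [hsupp p hp] using mul_nonneg ht0.le hs0.le
      · rw [not_lt] at hp
        refine (add_mul_log_add_le (hδ.trans_le hp) (h0' p)).trans ?_
        have h1 : (t * k p) ^ 2 / z p ≤ t * s := by
          rw [div_le_iff₀ (hδ.trans_le hp), mul_pow]
          have h2 : k p ^ 2 ≤ 1 := by
            rw [← sq_abs]
            exact pow_le_one₀ (abs_nonneg _) (hk1 p)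
          calc t ^ 2 * k p ^ 2 ≤ t ^ 2 * 1 := by gcongr
            _ = t * s * δ := by rw [ht]; ring
            _ ≤ t * s * z p := by gcongr
        linarith
    have hbd' : Integrable (fun p => z p * Real.log (z p) +
        t * (k p * (Real.log (z p) + 1))) κ := h.integrable_mul_log.add (hklog.const_mul t)
    have hbd := hbd'.add (integrable_const (t * s))
    have hlog := integrable_mul_log_of_le hm' h0' hbd hle
    have h1 := h.le_of_isCouplingDensity _ hdens hlog
    have h2 := integral_mono hlog hbd hle
    rw [integral_add' hbd' (integrable_const _), integral_add h.integrable_mul_log (hklog.const_mul t), integral_const_mul, integral_const,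
      probReal_univ, one_smul] at h2
    have h3 : ∫ p, (z p + t * k p) * c p ∂κ = ∫ p, z p * c p ∂κ + t * ∫ p, k p * c p ∂κ := by
      rw [← integral_const_mul, ← integral_add hzc (hkc.const_mul _)]
      congr with p
      ring
    rw [h3] at h1
    have h4 := mul_le_mul_of_nonneg_left h2 hε.le
    refine le_of_mul_le_mul_left ?_ ht0
    rw [hIeq]
    linarith
  by_contra hneg
  rw [not_le] at hneg
  -- For this `s`, `I + ε s ≤ I / 2 < 0`.
  have h1 := key (min 1 (-I / (2 * ε))) (lt_min one_pos (div_pos (by linarith) (by linarith)))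
    (min_le_left _ _)
  have h2 : ε * min 1 (-I / (2 * ε)) ≤ ε * (-I / (2 * ε)) :=
    mul_le_mul_of_nonneg_left (min_le_right _ _) hε.le
  have h3 : ε * (-I / (2 * ε)) = -I / 2 := by field_simp
  linarith

end Optimality

/-! ### Exchange of coordinates and vanishing cross differences -/

section Exchange

variable {X Y : Type*}

/-- The cross difference `ψ(x, y) + ψ(x', y') - ψ(x, y') - ψ(x', y)`. -/
def crossDiff (ψ : X × Y → ℝ) (r : (X × Y) × (X × Y)) : ℝ :=
  ψ r.1 + ψ r.2 - ψ (r.1.1, r.2.2) - ψ (r.2.1, r.1.2)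

/-- All four corners `(x, y)`, `(x', y')`, `(x, y')`, `(x', y)` lie in `S`. -/
def cornersIn (S : Set (X × Y)) : Set ((X × Y) × (X × Y)) :=
  {r | r.1 ∈ S ∧ r.2 ∈ S ∧ (r.1.1, r.2.2) ∈ S ∧ (r.2.1, r.1.2) ∈ S}

/-- Exchange of the second coordinates. -/
def exchangeRight (r : (X × Y) × (X × Y)) : (X × Y) × (X × Y) :=
  ((r.1.1, r.2.2), (r.2.1, r.1.2))

variable {ψ : X × Y → ℝ} {S : Set (X × Y)}

/-- A bounded weight with the sign of `-crossDiff ψ`. -/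
noncomputable def exchangeWeight (ψ : X × Y → ℝ) (S : Set (X × Y)) (r : (X × Y) × (X × Y)) : ℝ :=
  (cornersIn S).indicator (fun r => -(crossDiff ψ r / (1 + |crossDiff ψ r|))) r

theorem abs_exchangeWeight_le_one (r : (X × Y) × (X × Y)) : |exchangeWeight ψ S r| ≤ 1 := by
  unfold exchangeWeight Set.indicator
  split_ifs
  · rw [abs_neg, abs_div, abs_of_pos (a := 1 + _) (by positivity), div_le_one (by positivity)]
    linarith
  · simp

theorem exchangeWeight_eq_zero {r : (X × Y) × (X × Y)} (h : r.1 ∉ S) :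
    exchangeWeight ψ S r = 0 :=
  Set.indicator_of_notMem (fun hr => h hr.1) _

theorem crossDiff_exchangeRight (r : (X × Y) × (X × Y)) :
    crossDiff ψ (exchangeRight r) = -crossDiff ψ r := by
  simp only [crossDiff, exchangeRight]; ring

theorem crossDiff_swap (r : (X × Y) × (X × Y)) : crossDiff ψ r.swap = crossDiff ψ r := by
  simp only [crossDiff, Prod.fst_swap, Prod.snd_swap]; ring

/-- This antisymmetry is what gives the exchange direction zero marginals. -/
theorem exchangeWeight_exchangeRight (r : (X × Y) × (X × Y)) :
    exchangeWeight ψ S (exchangeRight r) = -exchangeWeight ψ S r := by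
  have h : exchangeRight r ∈ cornersIn S ↔ r ∈ cornersIn S := by
    simp only [cornersIn, exchangeRight, Set.mem_ofPred_eq]; tauto
  by_cases hr : r ∈ cornersIn S
  · rw [exchangeWeight, exchangeWeight, Set.indicator_of_mem hr, Set.indicator_of_mem (h.2 hr),
      crossDiff_exchangeRight, abs_neg, neg_div]
  · rw [exchangeWeight, exchangeWeight, Set.indicator_of_notMem hr,
      Set.indicator_of_notMem (mt h.1 hr), neg_zero]

theorem exchangeWeight_swap (r : (X × Y) × (X × Y)) :
    exchangeWeight ψ S r.swap = exchangeWeight ψ S r := by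
  have h : r.swap ∈ cornersIn S ↔ r ∈ cornersIn S := by
    simp only [cornersIn, Prod.fst_swap, Prod.snd_swap, Set.mem_ofPred_eq]; tauto
  by_cases hr : r ∈ cornersIn S
  · rw [exchangeWeight, exchangeWeight, Set.indicator_of_mem hr, Set.indicator_of_mem (h.2 hr),
      crossDiff_swap]
  · rw [exchangeWeight, exchangeWeight, Set.indicator_of_notMem hr,
      Set.indicator_of_notMem (mt h.1 hr)]

theorem exchangeWeight_mul_crossDiff (r : (X × Y) × (X × Y)) :
    exchangeWeight ψ S r * crossDiff ψ r =
      -(cornersIn S).indicator (fun r => crossDiff ψ r ^ 2 / (1 + |crossDiff ψ r|)) r := by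
  by_cases hr : r ∈ cornersIn S
  · rw [exchangeWeight, Set.indicator_of_mem hr, Set.indicator_of_mem hr]; ring
  · rw [exchangeWeight, Set.indicator_of_notMem hr, Set.indicator_of_notMem hr]; ring

variable [MeasurableSpace X] [MeasurableSpace Y]

theorem measurable_exchangeRight :
    Measurable (exchangeRight : (X × Y) × (X × Y) → (X × Y) × (X × Y)) := by
  unfold exchangeRight; fun_prop

theorem measurable_crossDiff (hψ : Measurable ψ) : Measurable (crossDiff ψ) := by
  unfold crossDiff; fun_prop

theorem measurableSet_cornersIn (hS : MeasurableSet S) : MeasurableSet (cornersIn S) := by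
  have h := measurable_exchangeRight (X := X) (Y := Y)
  exact (measurable_fst hS).inter ((measurable_snd hS).inter
    (((measurable_fst.comp h) hS).inter ((measurable_snd.comp h) hS)))

theorem measurable_exchangeWeight (hψ : Measurable ψ) (hS : MeasurableSet S) :
    Measurable (exchangeWeight ψ S) := by
  have h := measurable_crossDiff hψ
  exact Measurable.indicator (h.div (h.abs.const_add 1)).neg (measurableSet_cornersIn hS)

variable {μ : Measure X} {ν : Measure Y}

/-- The density of the signed measure that moves mass along the exchange of coordinates. -/
noncomputable def exchangeDirection (μ : Measure X) (ν : Measure Y) (ψ : X × Y → ℝ) (S : Set (X × Y))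
    (p : X × Y) : ℝ :=
  ∫ q, exchangeWeight ψ S (p, q) ∂(μ.prod ν)

theorem exchangeDirection_eq_zero {p : X × Y} (hp : p ∉ S) :
    exchangeDirection μ ν ψ S p = 0 := by
  have : ∀ q, exchangeWeight ψ S (p, q) = 0 := fun q => exchangeWeight_eq_zero hp
  simp [exchangeDirection, this]

variable [IsProbabilityMeasure μ] [IsProbabilityMeasure ν]

/-- The first `x` is left out, so that the marginal of the direction vanishes at every `x` and not
only a.e. -/
theorem measurePreserving_exchange_snd :
    MeasurePreserving (fun q : Y × (X × Y) => (q.2.2, (q.2.1, q.1)))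
      (ν.prod (μ.prod ν)) (ν.prod (μ.prod ν)) := by
  have h1 : MeasurePreserving (Prod.swap : Y × (X × Y) → (X × Y) × Y) (ν.prod (μ.prod ν))
      ((μ.prod ν).prod ν) := Measure.measurePreserving_swap
  have h2 := measurePreserving_prodAssoc μ ν ν
  have h3 : MeasurePreserving (Prod.map id Prod.swap : X × (Y × Y) → X × (Y × Y))
      (μ.prod (ν.prod ν)) (μ.prod (ν.prod ν)) :=
    (MeasurePreserving.id μ).prod Measure.measurePreserving_swap
  have h4 : MeasurePreserving (Prod.swap : (X × Y) × Y → Y × (X × Y)) ((μ.prod ν).prod ν)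
      (ν.prod (μ.prod ν)) := Measure.measurePreserving_swap
  exact h4.comp ((h2.symm _).comp (h3.comp (h2.comp h1)))

theorem measurePreserving_exchange_fst :
    MeasurePreserving (fun q : X × (X × Y) => (q.2.1, (q.1, q.2.2)))
      (μ.prod (μ.prod ν)) (μ.prod (μ.prod ν)) := by
  have h2 := measurePreserving_prodAssoc μ μ ν
  have h3 : MeasurePreserving (Prod.map Prod.swap id : (X × X) × Y → (X × X) × Y)
      ((μ.prod μ).prod ν) ((μ.prod μ).prod ν) :=
    Measure.measurePreserving_swap.prod (MeasurePreserving.id ν)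
  exact h2.comp (h3.comp (h2.symm _))

theorem measurePreserving_exchangeRight :
    MeasurePreserving exchangeRight ((μ.prod ν).prod (μ.prod ν))
      ((μ.prod ν).prod (μ.prod ν)) := by
  have h2 := measurePreserving_prodAssoc μ ν (μ.prod ν)
  have h3 := (MeasurePreserving.id μ).prod (measurePreserving_exchange_snd (μ := μ) (ν := ν))
  exact (h2.symm _).comp (h3.comp h2)

theorem measurable_exchangeDirection (hψ : Measurable ψ) (hS : MeasurableSet S) :
    Measurable (exchangeDirection μ ν ψ S) :=
  (StronglyMeasurable.integral_prod_right'
    (measurable_exchangeWeight hψ hS).stronglyMeasurable).measurable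

theorem abs_exchangeDirection_le_one (p : X × Y) : |exchangeDirection μ ν ψ S p| ≤ 1 := by
  have := norm_integral_le_of_norm_le_const (μ := μ.prod ν)
    (f := fun q => exchangeWeight ψ S (p, q)) (C := 1)
    (ae_of_all _ fun q => abs_exchangeWeight_le_one (p, q))
  simpa [exchangeDirection] using this

theorem integral_eq_zero_of_comp_eq_neg {Z : Type*} [MeasurableSpace Z] {κ : Measure Z}
    {T : Z → Z} (hT : MeasurePreserving T κ κ) {h : Z → ℝ} (hh : AEStronglyMeasurable h κ)
    (hneg : ∀ p, h (T p) = -h p) : ∫ p, h p ∂κ = 0 := by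
  have h1 := hT.map_eq ▸ integral_map (μ := κ) hT.aemeasurable (hT.map_eq.symm ▸ hh)
  simp only [hneg, integral_neg] at h1
  linarith

theorem integral_exchangeDirection_right (hψ : Measurable ψ) (hS : MeasurableSet S) (x : X) :
    ∫ y, exchangeDirection μ ν ψ S (x, y) ∂ν = 0 := by
  have hm : Measurable fun q : Y × (X × Y) => exchangeWeight ψ S ((x, q.1), q.2) :=
    (measurable_exchangeWeight hψ hS).comp (by fun_prop)
  have hi : Integrable (fun q : Y × (X × Y) => exchangeWeight ψ S ((x, q.1), q.2))
      (ν.prod (μ.prod ν)) :=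
    Integrable.of_bound hm.aestronglyMeasurable 1 (ae_of_all _ fun q => abs_exchangeWeight_le_one _)
  simp only [exchangeDirection]
  rw [← integral_prod _ hi]
  exact integral_eq_zero_of_comp_eq_neg measurePreserving_exchange_snd hm.aestronglyMeasurable
    fun q => exchangeWeight_exchangeRight ((x, q.1), q.2)

theorem integral_exchangeDirection_left (hψ : Measurable ψ) (hS : MeasurableSet S) (y : Y) :
    ∫ x, exchangeDirection μ ν ψ S (x, y) ∂μ = 0 := by
  have hm : Measurable fun q : X × (X × Y) => exchangeWeight ψ S ((q.1, y), q.2) :=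
    (measurable_exchangeWeight hψ hS).comp (by fun_prop)
  have hi : Integrable (fun q : X × (X × Y) => exchangeWeight ψ S ((q.1, y), q.2))
      (μ.prod (μ.prod ν)) :=
    Integrable.of_bound hm.aestronglyMeasurable 1 (ae_of_all _ fun q => abs_exchangeWeight_le_one _)
  simp only [exchangeDirection]
  rw [← integral_prod _ hi]
  refine integral_eq_zero_of_comp_eq_neg measurePreserving_exchange_fst hm.aestronglyMeasurable
    fun q => ?_
  -- Exchanging first coordinates is exchanging second coordinates followed by a swap of the two
  -- points, so the sign still flips.
  rw [← exchangeWeight_exchangeRight, ← exchangeWeight_swap]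
  rfl

/-- The weight vanishes unless `r.1 ∈ S`, so integrability of `ψ` on `S` suffices. -/
theorem integrable_exchangeWeight_mul (hψ : Measurable ψ) (hS : MeasurableSet S)
    (hψi : Integrable (S.indicator ψ) (μ.prod ν)) :
    Integrable (fun r => exchangeWeight ψ S r * ψ r.1) ((μ.prod ν).prod (μ.prod ν)) := by
  have h1 := (hψi.comp_fst (μ.prod ν)).bdd_mul
    (measurable_exchangeWeight hψ hS).aestronglyMeasurable
    (ae_of_all _ fun r => abs_exchangeWeight_le_one r)
  refine h1.congr (ae_of_all _ fun r => ?_)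
  by_cases hr : r.1 ∈ S
  · simp [hr]
  · simp [exchangeWeight_eq_zero hr]

theorem integral_exchangeDirection_mul (hψ : Measurable ψ) (hS : MeasurableSet S)
    (hψi : Integrable (S.indicator ψ) (μ.prod ν)) :
    ∫ p, exchangeDirection μ ν ψ S p * ψ p ∂(μ.prod ν) =
      ∫ r, exchangeWeight ψ S r * ψ r.1 ∂((μ.prod ν).prod (μ.prod ν)) := by
  rw [integral_prod _ (integrable_exchangeWeight_mul hψ hS hψi)]
  simp only [exchangeDirection, integral_mul_const]

theorem integrable_exchangeDirection_mul (hψ : Measurable ψ) (hS : MeasurableSet S)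
    (hψi : Integrable (S.indicator ψ) (μ.prod ν)) :
    Integrable (fun p => exchangeDirection μ ν ψ S p * ψ p) (μ.prod ν) := by
  have h := (integrable_exchangeWeight_mul hψ hS hψi).integral_prod_left
  simpa only [exchangeDirection, integral_mul_const] using h

/-- The identity, the swap, the exchange and their composition preserve the measure. They carry
`r.1` to the four corners, and the sign of the weight matches the sign of that corner in
`crossDiff`, so all four terms have equal integrals. -/
theorem integral_exchangeWeight_mul_crossDiff (hψ : Measurable ψ) (hS : MeasurableSet S)
    (hψi : Integrable (S.indicator ψ) (μ.prod ν)) :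
    Integrable (fun r => exchangeWeight ψ S r * crossDiff ψ r) ((μ.prod ν).prod (μ.prod ν)) ∧
    ∫ r, exchangeWeight ψ S r * crossDiff ψ r ∂((μ.prod ν).prod (μ.prod ν)) =
      4 * ∫ r, exchangeWeight ψ S r * ψ r.1 ∂((μ.prod ν).prod (μ.prod ν)) := by
  set κ := (μ.prod ν).prod (μ.prod ν) with hκ
  set F : (X × Y) × (X × Y) → ℝ := fun r => exchangeWeight ψ S r * ψ r.1 with hF
  have hFi : Integrable F κ := integrable_exchangeWeight_mul hψ hS hψi
  have hT : MeasurePreserving exchangeRight κ κ := measurePreserving_exchangeRight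
  have hW : MeasurePreserving (Prod.swap : (X × Y) × (X × Y) → _) κ κ :=
    Measure.measurePreserving_swap
  have hcomp : ∀ {T : (X × Y) × (X × Y) → (X × Y) × (X × Y)}, MeasurePreserving T κ κ →
      Integrable (fun r => F (T r)) κ ∧ ∫ r, F (T r) ∂κ = ∫ r, F r ∂κ := fun {T} hT =>
    ⟨(hT.integrable_comp hFi.aestronglyMeasurable).2 hFi, by
      conv_rhs => rw [← hT.map_eq]
      exact (integral_map hT.aemeasurable (hT.map_eq.symm ▸ hFi.aestronglyMeasurable)).symm⟩
  obtain ⟨i1, e1⟩ := hcomp hT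
  obtain ⟨i2, e2⟩ := hcomp hW
  obtain ⟨i3, e3⟩ := hcomp (hT.comp hW)
  have hsum : (fun r => exchangeWeight ψ S r * crossDiff ψ r) =
      fun r => (F r + F r.swap) + (F (exchangeRight r) + F ((exchangeRight ∘ Prod.swap) r)) := by
    funext r
    simp only [hF, Function.comp_apply, exchangeWeight_exchangeRight, exchangeWeight_swap]
    simp only [crossDiff, exchangeRight, Prod.fst_swap, Prod.snd_swap]
    ring
  have i4 : Integrable (fun r => F r + F r.swap) κ := hFi.add i2
  have i5 : Integrable (fun r => F (exchangeRight r) + F ((exchangeRight ∘ Prod.swap) r)) κ :=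
    i1.add i3
  rw [hsum]
  refine ⟨i4.add i5, ?_⟩
  rw [integral_add i4 i5, integral_add hFi i2, integral_add i1 i3, e1, e2, e3]
  ring

theorem crossDiff_eq_zero_of_integral_nonneg (hψ : Measurable ψ) (hS : MeasurableSet S)
    (hψi : Integrable (S.indicator ψ) (μ.prod ν))
    (h : 0 ≤ ∫ p, exchangeDirection μ ν ψ S p * ψ p ∂(μ.prod ν)) :
    ∀ᵐ r ∂((μ.prod ν).prod (μ.prod ν)), r ∈ cornersIn S → crossDiff ψ r = 0 := by
  obtain ⟨hi, he⟩ := integral_exchangeWeight_mul_crossDiff hψ hS hψi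
  rw [integral_exchangeDirection_mul hψ hS hψi] at h
  have hnn : ∀ r, 0 ≤ (cornersIn S).indicator
      (fun r => crossDiff ψ r ^ 2 / (1 + |crossDiff ψ r|)) r :=
    fun r => Set.indicator_nonneg (fun r _ => by positivity) r
  simp only [exchangeWeight_mul_crossDiff, integral_neg] at hi he
  have h0 : ∫ r, (cornersIn S).indicator (fun r => crossDiff ψ r ^ 2 / (1 + |crossDiff ψ r|)) r
      ∂((μ.prod ν).prod (μ.prod ν)) = 0 :=
    le_antisymm (by linarith) (integral_nonneg hnn)
  rw [integral_eq_zero_iff_of_nonneg hnn (by simpa using hi.neg)] at h0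
  filter_upwards [h0] with r hr hrS
  rw [Set.indicator_of_mem hrS, Pi.zero_apply, div_eq_zero_iff] at hr
  rcases hr with hr | hr
  · exact pow_eq_zero_iff two_ne_zero |>.1 hr
  · have := abs_nonneg (crossDiff ψ r)
    linarith

/-- A function with vanishing cross differences splits into a sum of functions of one variable. -/
theorem exists_ae_eq_add_of_crossDiff_eq_zero (hψ : Measurable ψ)
    (h : ∀ᵐ r ∂((μ.prod ν).prod (μ.prod ν)), crossDiff ψ r = 0) :
    ∃ (f : X → ℝ) (g : Y → ℝ), Measurable f ∧ Measurable g ∧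
      ∀ᵐ p ∂(μ.prod ν), ψ p = f p.1 + g p.2 := by
  -- By Fubini some base point `p₀` has vanishing cross difference with a.e. `p`; solving for `ψ p`
  -- gives the splitting.
  obtain ⟨p₀, hp₀⟩ := (Measure.ae_ae_of_ae_prod h).exists
  refine ⟨fun x => ψ (x, p₀.2) - ψ p₀, fun y => ψ (p₀.1, y),
    (hψ.comp measurable_prodMk_right).sub_const _, hψ.comp measurable_prodMk_left, ?_⟩
  filter_upwards [hp₀] with p hp
  simp only [crossDiff] at hp
  linarith

end Exchange

/-! ### Gibbs form of the optimizer -/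

section Existence

variable {X Y : Type*} [MeasurableSpace X] [MeasurableSpace Y] {μ : Measure X} {ν : Measure Y}
  [IsProbabilityMeasure μ] [IsProbabilityMeasure ν] {c z : X × Y → ℝ} {ε : ℝ}

/-- The variation is allowed only where `z ≥ δ`; since `z > 0` a.e. at all four corners, the levels
`δ = 1/(n + 1)` exhaust almost every quadruple. -/
theorem IsOptimalDensity.crossDiff_eq_zero (hε : 0 < ε) (hc : Measurable c)
    (hcint : ∀ ρ ∈ Cpl μ ν, Integrable c ρ) (h : IsOptimalDensity c ε μ ν z) :
    ∀ᵐ r ∂((μ.prod ν).prod (μ.prod ν)), crossDiff (fun p => c p + ε * Real.log (z p)) r = 0 := by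
  set ψ : X × Y → ℝ := fun p => c p + ε * Real.log (z p) with hψ_def
  have hzm := h.measurable
  have hψ : Measurable ψ := by fun_prop
  have hlevel : ∀ n : ℕ, ∀ᵐ r ∂((μ.prod ν).prod (μ.prod ν)),
      r ∈ cornersIn {p | 1 / ((n : ℝ) + 1) ≤ z p} → crossDiff ψ r = 0 := by
    intro n
    set δ : ℝ := 1 / ((n : ℝ) + 1) with hδ_def
    have hδ : 0 < δ := by positivity
    have hS : MeasurableSet {p | δ ≤ z p} := measurableSet_le measurable_const hzm
    -- On the level set, `log δ ≤ log z ≤ z`.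
    have hlog : Integrable ({p | δ ≤ z p}.indicator fun p => Real.log (z p)) (μ.prod ν) := by
      refine integrable_of_le_of_le (hzm.log.indicator hS).aestronglyMeasurable
        (ae_of_all _ fun p => ?_) (ae_of_all _ fun p => ?_)
        (integrable_const (-|Real.log δ|)) h.integrable
      · by_cases hp : δ ≤ z p
        · rw [Set.indicator_of_mem (show p ∈ {p | δ ≤ z p} from hp)]
          exact (neg_abs_le _).trans (Real.log_le_log hδ hp)
        · rw [Set.indicator_of_notMem (show p ∉ {p | δ ≤ z p} from hp)]
          exact neg_nonpos.2 (abs_nonneg _)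
      · by_cases hp : δ ≤ z p
        · rw [Set.indicator_of_mem (show p ∈ {p | δ ≤ z p} from hp)]
          exact Real.log_le_self (h.nonneg p)
        · rw [Set.indicator_of_notMem (show p ∉ {p | δ ≤ z p} from hp)]
          exact h.nonneg p
    have hψi : Integrable ({p | δ ≤ z p}.indicator ψ) (μ.prod ν) := by
      refine (((hcint _ (prod_mem_Cpl μ ν)).indicator hS).add (hlog.const_mul ε)).congr
        (ae_of_all _ fun p => ?_)
      by_cases hp : δ ≤ z p <;> simp [Set.indicator_apply, hp, hψ_def]
    refine crossDiff_eq_zero_of_integral_nonneg hψ hS hψi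
      (h.integral_mul_nonneg hε hcint hδ (measurable_exchangeDirection hψ hS)
        abs_exchangeDirection_le_one (fun p hp => exchangeDirection_eq_zero hp.not_ge)
        (integral_exchangeDirection_right hψ hS) (integral_exchangeDirection_left hψ hS)
        (integrable_exchangeDirection_mul hψ hS hψi))
  have hpos := h.ae_pos hε hcint
  have hfst : ∀ᵐ r ∂((μ.prod ν).prod (μ.prod ν)), 0 < z r.1 :=
    Measure.quasiMeasurePreserving_fst.ae hpos
  have hsnd : ∀ᵐ r ∂((μ.prod ν).prod (μ.prod ν)), 0 < z r.2 :=
    Measure.quasiMeasurePreserving_snd.ae hpos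
  -- The exchange carries positivity to the mixed corners.
  have hT := (measurePreserving_exchangeRight (μ := μ) (ν := ν)).quasiMeasurePreserving
  filter_upwards [ae_all_iff.2 hlevel, hfst, hsnd, hT.ae hfst, hT.ae hsnd] with r hr h1 h2 h3 h4
  obtain ⟨n, hn⟩ := exists_nat_one_div_lt (lt_min (lt_min h1 h2) (lt_min h3 h4))
  simp only [lt_min_iff] at hn
  exact hr n ⟨hn.1.1.le, hn.1.2.le, hn.2.1.le, hn.2.2.le⟩

theorem IsPrimalOptimal.exists_hasGibbsDensity (hε : 0 < ε) (hc : Measurable c) {m : ℝ}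
    (hm : ∀ p, m ≤ c p) (hcint : ∀ ρ ∈ Cpl μ ν, Integrable c ρ) {π : Measure (X × Y)}
    (h : IsPrimalOptimal c ε μ ν π) :
    ∃ (f : X → ℝ) (g : Y → ℝ), Measurable f ∧ Measurable g ∧ HasGibbsDensity c ε μ ν π f g := by
  obtain ⟨z, hz, hπ⟩ := h.exists_isOptimalDensity hε hm hcint
  have hzm := hz.measurable
  obtain ⟨f, g, hf, hg, hfg⟩ := exists_ae_eq_add_of_crossDiff_eq_zero (by fun_prop)
    (hz.crossDiff_eq_zero hε hc hcint)
  refine ⟨f, g, hf, hg, hasGibbsDensity_of_eq_withDensity hc hf hg ?_⟩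
  rw [hπ]
  refine withDensity_congr_ae ?_
  filter_upwards [hfg, hz.ae_pos hε hcint] with p hp hpos
  rw [← hp, add_sub_cancel_left, mul_div_cancel_left₀ _ hε.ne', Real.exp_log hpos]

end Existence

end EntropicOT

/-! ### The theorem -/

theorem theorem4p2 {X Y : Type*}
    [TopologicalSpace X] [PolishSpace X] [MeasurableSpace X] [BorelSpace X]
    [TopologicalSpace Y] [PolishSpace Y] [MeasurableSpace Y] [BorelSpace Y]
    (μ : Measure X) [IsProbabilityMeasure μ] (ν : Measure Y) [IsProbabilityMeasure ν]
    (c : X × Y → ℝ) (hc : Measurable c) (hc_below : ∃ m : ℝ, ∀ p, m ≤ c p)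
    (hc_above : ∃ (a : X → ℝ) (b : Y → ℝ), Integrable a μ ∧ Integrable b ν ∧
      ∀ x y, c (x, y) ≤ a x + b y)
    (ε : ℝ) (hε : 0 < ε) (π : Measure (X × Y)) (hπ : π ∈ EntropicOT.Cpl μ ν) :
    (EntropicOT.IsPrimalOptimal c ε μ ν π ↔
      ∃ (f : X → ℝ) (g : Y → ℝ), Measurable f ∧ Measurable g ∧
        EntropicOT.HasGibbsDensity c ε μ ν π f g) ∧
    (∀ (f : X → ℝ) (g : Y → ℝ), Measurable f → Measurable g →
      EntropicOT.HasGibbsDensity c ε μ ν π f g →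
        ∃ f' : X → EReal, (∀ᵐ x ∂μ, f' x = (f x : EReal)) ∧
          EntropicOT.IsDualOptimal c ε μ ν f' (fun y => (g y : EReal))) := by
  obtain ⟨m, hm⟩ := hc_below
  obtain ⟨a, b, ha, hb, hab⟩ := hc_above
  have hcint : ∀ ρ ∈ EntropicOT.Cpl μ ν, Integrable c ρ := fun ρ hρ =>
    EntropicOT.Cpl.integrable_cost hρ hc hm ha hb hab
  refine ⟨⟨fun h => h.exists_hasGibbsDensity hε hc hm hcint, ?_⟩, fun f g hf hg h => ?_⟩
  · rintro ⟨f, g, hf, hg, h⟩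
    obtain ⟨hfi, hgi⟩ := h.integrable_potentials hε hπ hc hm ha hb hab hf hg
    exact h.isPrimalOptimal hε hπ hc hm (hcint π hπ) hf hg hfi hgi
  · obtain ⟨hfi, hgi⟩ := h.integrable_potentials hε hπ hc hm ha hb hab hf hg
    exact h.exists_isDualOptimal hε hπ hc hm (hcint π hπ) hf hg hfi hgi
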